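/- Let $X$ be a finite-dimensional complex normed space, $A:X\to X$ a (bounded) linear operator, $\omega>0$ and $c\in\mathbb C\setminus\{0\}$. Assume that $c\ne e^{\omega\lambda}$ for all $\lambda\in\sigma(A)$. Let $g:\mathbb R\times X\to X$ be continuous with $g(t+\omega,cy)=c\,g(t,y)$ for all $t\in\mathbb R$, $y\in X$, and suppose that there are constants $g_1\ge0$, $g_2\ge0$ with $\|g(t,y)\|\le g_1+g_2\|y\|$ for all $t\in\mathbb R$, $y\in X$. For $t,s\in[0,\omega]$ put $$K(t,s)=\begin{cases}c\,e^{A(t-s)}(cI-e^{A\omega})^{-1}&\text{if } s\le t,\\ e^{A(\omega+t-s)}(cI-e^{A\omega})^{-1}&\text{if } s>t,\end{cases}\qquad M=\max_{t\in[0,\omega]}\int_0^\omega\|K(t,s)\|\,ds .$$ If $g_2M<1$, then the equation $\dot y=Ay+g(t,y)$ has an $(\omega,c)$-periodic solution, that is, a differentiable $y:\mathbb R\to X$ with $\dot y(t)=Ay(t)+g(t,y(t))$ and $y(t+\omega)=c\,y(t)$ for all $t\in\mathbb R$, such that $$\|y\|_0:=\max_{t\in[0,\omega]}\|y(t)\|\le\frac{Mg_1}{1-Mg_2}.$$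 -/

import Mathlib

/-- `f : ℝ → X` is `(ω, c)`-periodic: `ω > 0`, `c ≠ 0` and `f (t + ω) = c f(t)` for all real `t`. -/
def IsOmegaCPeriodic {X : Type*} [NormedAddCommGroup X] [NormedSpace ℂ X]
    (ω : ℝ) (c : ℂ) (f : ℝ → X) : Prop :=
  0 < ω ∧ c ≠ 0 ∧ ∀ t : ℝ, f (t + ω) = c • f t

/-- The operator `e^{At}` for a bounded operator `A` and a real time `t`. -/
noncomputable def expOp {X : Type*} [NormedAddCommGroup X] [NormedSpace ℂ X]
    (A : X →L[ℂ] X) (t : ℝ) : X →L[ℂ] X :=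
  NormedSpace.exp ((t : ℂ) • A)

/-- The operator `(cI - e^{Aω})⁻¹` (it is used only where `cI - e^{Aω}` is invertible). -/
noncomputable def resolventOp {X : Type*} [NormedAddCommGroup X] [NormedSpace ℂ X]
    (A : X →L[ℂ] X) (ω : ℝ) (c : ℂ) : X →L[ℂ] X :=
  Ring.inverse (c • (1 : X →L[ℂ] X) - expOp A ω)

/-- The Green kernel `K(t,s)`, for `t, s ∈ [0, ω]`, of `y' = Ay + f(t)`, `y(ω) = c y(0)`. -/
noncomputable def greenKernel {X : Type*} [NormedAddCommGroup X] [NormedSpace ℂ X]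
    (A : X →L[ℂ] X) (ω : ℝ) (c : ℂ) (t s : ℝ) : X →L[ℂ] X :=
  if s ≤ t then c • (expOp A (t - s) * resolventOp A ω c)
  else expOp A (ω + t - s) * resolventOp A ω c

/-- `M = max_{t ∈ [0, ω]} ∫_0^ω ‖K(t,s)‖ ds`. -/
noncomputable def greenBound {X : Type*} [NormedAddCommGroup X] [NormedSpace ℂ X]
    (A : X →L[ℂ] X) (ω : ℝ) (c : ℂ) : ℝ :=
  sSup ((fun t : ℝ => ∫ s in (0 : ℝ)..ω, ‖greenKernel A ω c t s‖) '' Set.Icc 0 ω)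

theorem continuous_expOp {X : Type*} [NormedAddCommGroup X] [NormedSpace ℂ X] [CompleteSpace X]
    (A : X →L[ℂ] X) : Continuous (expOp A) := by
  unfold expOp
  let _ : NormedAlgebra ℚ (X →L[ℂ] X) := NormedAlgebra.restrictScalars ℚ ℂ (X →L[ℂ] X)
  exact NormedSpace.exp_continuous.comp (by fun_prop)

/-- The integrals `∫_0^ω ‖K(t,s)‖ ds` split at `s = t` into integrals of continuous
functions. -/
theorem integral_norm_greenKernel {X : Type*} [NormedAddCommGroup X] [NormedSpace ℂ X]
    [CompleteSpace X] (A : X →L[ℂ] X) {ω : ℝ} (c : ℂ) {t : ℝ} (ht : t ∈ Set.Icc 0 ω) :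
    IntervalIntegrable (fun s => ‖greenKernel A ω c t s‖) MeasureTheory.volume 0 ω ∧
    ∫ s in (0 : ℝ)..ω, ‖greenKernel A ω c t s‖ =
      (∫ s in (0 : ℝ)..t, ‖c • (expOp A (t - s) * resolventOp A ω c)‖) +
      ((∫ s in (0 : ℝ)..ω, ‖expOp A (ω + t - s) * resolventOp A ω c‖) -
        ∫ s in (0 : ℝ)..t, ‖expOp A (ω + t - s) * resolventOp A ω c‖) := by
  have hE := continuous_expOp A
  have h1 : Continuous fun s : ℝ => ‖c • (expOp A (t - s) * resolventOp A ω c)‖ := by fun_prop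
  have h2 : Continuous fun s : ℝ => ‖expOp A (ω + t - s) * resolventOp A ω c‖ := by fun_prop
  have e1 : Set.EqOn (fun s : ℝ => ‖c • (expOp A (t - s) * resolventOp A ω c)‖)
      (fun s => ‖greenKernel A ω c t s‖) (Set.uIoc 0 t) := by
    intro s hs
    rw [Set.uIoc_of_le ht.1] at hs
    simp [greenKernel, hs.2]
  have e2 : Set.EqOn (fun s : ℝ => ‖expOp A (ω + t - s) * resolventOp A ω c‖)
      (fun s => ‖greenKernel A ω c t s‖) (Set.uIoc t ω) := by
    intro s hs
    rw [Set.uIoc_of_le ht.2] at hs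
    simp [greenKernel, not_le.mpr hs.1]
  have i1 := (h1.intervalIntegrable (μ := MeasureTheory.volume) 0 t).congr e1
  have i2 := (h2.intervalIntegrable (μ := MeasureTheory.volume) t ω).congr e2
  refine ⟨i1.trans i2, ?_⟩
  rw [← intervalIntegral.integral_add_adjacent_intervals i1 i2,
    intervalIntegral.integral_interval_sub_left (h2.intervalIntegrable _ _)
      (h2.intervalIntegrable _ _)]
  congr 1
  · exact intervalIntegral.integral_congr_ae (Filter.Eventually.of_forall fun s hs => (e1 hs).symm)
  · exact intervalIntegral.integral_congr_ae (Filter.Eventually.of_forall fun s hs => (e2 hs).symm)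

/-- The supremum in the definition of `greenBound` is a maximum. -/
theorem isGreatest_greenBound {X : Type*} [NormedAddCommGroup X] [NormedSpace ℂ X]
    [CompleteSpace X] (A : X →L[ℂ] X) {ω : ℝ} (hω : 0 < ω) (c : ℂ) :
    IsGreatest ((fun t : ℝ => ∫ s in (0 : ℝ)..ω, ‖greenKernel A ω c t s‖) '' Set.Icc 0 ω)
      (greenBound A ω c) := by
  have hE := continuous_expOp A
  refine IsCompact.isGreatest_sSup (isCompact_Icc.image_of_continuousOn ?_)
    ((Set.nonempty_Icc.mpr hω.le).image _)
  refine ContinuousOn.congr (Continuous.continuousOn ?_)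
    fun t ht => (integral_norm_greenKernel A c ht).2
  refine Continuous.add ?_ (Continuous.sub ?_ ?_)
  · exact intervalIntegral.continuous_parametric_intervalIntegral_of_continuous
      (by unfold Function.uncurry; fun_prop) continuous_id
  · exact intervalIntegral.continuous_parametric_intervalIntegral_of_continuous
      (by unfold Function.uncurry; fun_prop) continuous_const
  · exact intervalIntegral.continuous_parametric_intervalIntegral_of_continuous
      (by unfold Function.uncurry; fun_prop) continuous_id

/-!
On `[0, ω]` the boundary value problem `y' = Ay + g(t, y)`, `y(ω) = c y(0)` is the fixed point
equation `y(t) = ∫₀^ω K(t, s) g(s, y(s)) ds`, where the Green kernel `K` exists because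
`cI - e^{Aω}` is invertible: a vector in its kernel would give an eigenvalue `z` of `A` with
`e^{ωz} = c` (`isUnit_smul_one_sub_expOp`). The right side is a continuous operator on
`C([0, ω], X)` that maps bounded sets to bounded sets of uniformly Lipschitz functions, hence to
relatively compact sets. Since the linear operator with kernel `K` has norm at most `M`, the growth
bound on `g` and `g₂ M < 1` give an invariant ball, and Schauder's theorem
(`exists_fixedPoint_of_range_subset_isCompact`) a fixed point; a fixed point satisfies
`‖y‖ ≤ M (g₁ + g₂ ‖y‖)`, which is the bound claimed
(`exists_greenOperator_superposition_eq`). The fixed point extends to a continuous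
`(ω, c)`-periodic function `Y` on the line. The forcing term `g(t, Y(t))` is then continuous and
`(ω, c)`-periodic, so the variation of constants formula gives an `(ω, c)`-periodic solution of the
linear equation with this forcing; it agrees with `Y` on `[0, ω]`, hence everywhere. In this way no
derivatives have to be glued at the multiples of `ω`.

Schauder's theorem is reduced to Brouwer's by finite `ε`-nets, and Brouwer's theorem is proved by
an integral argument in the manner of Milnor and Rogers. For a `C¹` map `h` that vanishes outside a
ball `B`, the change of variables formula
`∫_B det(1 + t Dh) q(‖x + t h‖²) = ∫_B q(‖x‖²)`, with `q` a polynomial, holds for small `t`, where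
`x ↦ x + t h(x)` is a diffeomorphism; as the left side is a polynomial in `t`, it holds for `t = 1`
(`integral_det_mul_eval_eq`). With `q` close to a bump function at `0` this shows that
`x ↦ x + h(x)` has a zero.
-/

/-! ### Brouwer's fixed point theorem -/

open Polynomial in
theorem exists_polynomial_eval_eq_det {E : Type*} [NormedAddCommGroup E] [NormedSpace ℝ E]
    [FiniteDimensional ℝ E] (A : E →L[ℝ] E) :
    ∃ p : ℝ[X], p.natDegree ≤ Module.finrank ℝ E ∧
      ∀ t : ℝ, p.eval t = ((1 : E →L[ℝ] E) + t • A).det := by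
  let b := Module.finBasis ℝ E
  let M := LinearMap.toMatrix b b (A : E →ₗ[ℝ] E)
  refine ⟨Matrix.det ((X : ℝ[X]) • M.map C + (1 : Matrix _ _ ℝ).map C), ?_, fun t => ?_⟩
  · simpa using Polynomial.natDegree_det_X_add_C_le M 1
  · have h : LinearMap.toMatrix b b (((1 : E →L[ℝ] E) + t • A : E →L[ℝ] E) : E →ₗ[ℝ] E) =
        1 + t • M := by
      rw [← LinearMap.toMatrix_one b, ← map_smul, ← map_add]
      rfl
    rw [← coe_evalRingHom, RingHom.map_det, ContinuousLinearMap.det, ← LinearMap.det_toMatrix b, h]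
    congr 1
    ext i j
    by_cases hij : i = j <;> simp [hij, add_comm, mul_comm t]

open Polynomial in
/-- Lagrange interpolation: the value at `a` of a polynomial of degree less than `n` is a linear
combination, with coefficients that do not depend on the polynomial, of its values at `n` nodes. -/
theorem exists_eval_eq_sum_mul_eval {n : ℕ} {v : ℕ → ℝ} (hv : Function.Injective v) (a : ℝ) :
    ∃ L : ℕ → ℝ, ∀ p : ℝ[X], p.natDegree < n →
      p.eval a = ∑ i ∈ Finset.range n, L i * p.eval (v i) := by
  refine ⟨fun i => (Lagrange.basis (Finset.range n) v i).eval a, fun p hp => ?_⟩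
  have hd : p.degree < (Finset.range n).card := by
    rw [Finset.card_range]
    exact lt_of_le_of_lt degree_le_natDegree (by exact_mod_cast hp)
  conv_lhs => rw [Lagrange.eq_interpolate hv.injOn hd]
  rw [Lagrange.interpolate_apply, eval_finsetSum]
  exact Finset.sum_congr rfl fun i _ => by rw [eval_mul, eval_C, mul_comm]

/-- A perturbation of the identity by a strict contraction is bijective. -/
theorem bijective_add_of_lipschitzWith {E : Type*} [NormedAddCommGroup E] [NormedSpace ℝ E]
    [CompleteSpace E] {k : E → E} {C : NNReal} (hk : LipschitzWith C k) (hC : C < 1) :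
    Function.Bijective fun x => x + k x := by
  have hf : ApproximatesLinearOn (fun x => x + k x)
      ((ContinuousLinearEquiv.refl ℝ E : E ≃L[ℝ] E) : E →L[ℝ] E) Set.univ C := by
    intro x _ y _
    simpa [add_sub_add_comm] using (lipschitzWith_iff_norm_sub_le.1 hk x y)
  have hN : Subsingleton E ∨
      C < ‖((ContinuousLinearEquiv.refl ℝ E).symm : E →L[ℝ] E)‖₊⁻¹ := by
    rcases subsingleton_or_nontrivial E with h | h
    · exact Or.inl h
    · right
      simpa using hC
  exact ⟨Set.injOn_univ.1 (hf.injOn hN), hf.surjective hN⟩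


theorem image_closedBall_of_bijective {E : Type*} [NormedAddCommGroup E] {F : E → E} {R : ℝ}
    (hF : Function.Bijective F) (hR : ∀ x, R < ‖x‖ → F x = x) :
    F '' Metric.closedBall 0 R = Metric.closedBall 0 R := by
  ext y
  simp only [Set.mem_image, mem_closedBall_zero_iff]
  constructor
  · rintro ⟨x, hx, rfl⟩
    by_contra! h
    rw [hF.1 (hR _ h)] at h
    exact h.not_ge hx
  · intro hy
    obtain ⟨x, rfl⟩ := hF.2 y
    refine ⟨x, ?_, rfl⟩
    by_contra! h
    rw [hR x h] at hy
    exact h.not_ge hy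

open MeasureTheory Metric in
/-- For small `t ≥ 0` the map `x ↦ x + t h(x)` is a diffeomorphism that preserves orientation and
maps the ball that carries `h` onto itself, so the change of variables formula applies on that
ball. -/
theorem exists_forall_integral_det_mul_eq {E : Type*} [NormedAddCommGroup E] [NormedSpace ℝ E]
    [FiniteDimensional ℝ E] [MeasurableSpace E] [BorelSpace E] (μ : Measure E) [μ.IsAddHaarMeasure]
    {h : E → E} (hh : ContDiff ℝ 1 h) {R : ℝ} (hR : ∀ x, R < ‖x‖ → h x = 0) (ψ : E → ℝ) :
    ∃ δ > 0, ∀ t : ℝ, 0 ≤ t → t < δ →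
      ∫ x in closedBall 0 R, (1 + t • fderiv ℝ h x).det * ψ (x + t • h x) ∂μ =
        ∫ x in closedBall 0 R, ψ x ∂μ := by
  have : CompleteSpace E := FiniteDimensional.complete ℝ E
  have hcs : HasCompactSupport h :=
    HasCompactSupport.intro (isCompact_closedBall 0 R) fun x hx => hR x (by simpa using hx)
  obtain ⟨C, hC⟩ := hh.lipschitzWith_of_hasCompactSupport hcs one_ne_zero
  have hdet : ∀ᶠ A : E →L[ℝ] E in nhds 1, 0 < A.det :=
    ContinuousLinearMap.continuous_det.continuousAt.eventually_const_lt
      (by simp [ContinuousLinearMap.det])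
  obtain ⟨η, hη, hball⟩ := Metric.eventually_nhds_iff.1 hdet
  refine ⟨min 1 η / (C + 1), by positivity, fun t ht0 ht => ?_⟩
  rw [lt_div_iff₀ (by positivity)] at ht
  have htC : t * C < min 1 η := by nlinarith
  have hderiv : ∀ x, HasFDerivAt (fun x => x + t • h x) (1 + t • fderiv ℝ h x) x := fun x =>
    (hasFDerivAt_id x).add (((hh.differentiable one_ne_zero) x).hasFDerivAt.const_smul t)
  have hlip : LipschitzWith (t.toNNReal * C) fun x => t • h x := by
    refine lipschitzWith_iff_norm_sub_le.2 fun x y => ?_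
    rw [← smul_sub, norm_smul, Real.norm_of_nonneg ht0, NNReal.coe_mul, mul_assoc,
      Real.coe_toNNReal t ht0]
    exact mul_le_mul_of_nonneg_left (lipschitzWith_iff_norm_sub_le.1 hC x y) ht0
  have hbij := bijective_add_of_lipschitzWith hlip (by
    rw [← NNReal.coe_lt_coe, NNReal.coe_mul, Real.coe_toNNReal t ht0]
    exact htC.trans_le (min_le_left _ _))
  have hpos : ∀ x, 0 < (1 + t • fderiv ℝ h x).det := fun x => by
    refine hball ?_
    rw [dist_eq_norm, add_sub_cancel_left, norm_smul, Real.norm_of_nonneg ht0]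
    exact (mul_le_mul_of_nonneg_left (norm_fderiv_le_of_lipschitz ℝ hC) ht0).trans_lt
      (htC.trans_le (min_le_right _ _))
  have himg := image_closedBall_of_bijective (R := R) hbij fun x hx => by simp [hR x hx]
  conv_rhs => rw [← himg]
  rw [integral_image_eq_integral_abs_det_fderiv_smul μ measurableSet_closedBall
    (fun x _ => (hderiv x).hasFDerivWithinAt) hbij.1.injOn]
  simp_rw [abs_of_pos (hpos _), smul_eq_mul]

open MeasureTheory Metric Polynomial in
/-- The change of variables formula for `x ↦ x + h(x)`, without any assumption of injectivity, for
integrands that are polynomials in `‖x‖²`. Both sides agree with `h` replaced by `t h` for small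
`t`; the left side is a polynomial in `t`, so they agree at `t = 1` too. -/
theorem integral_det_mul_eval_eq {E : Type*} [NormedAddCommGroup E] [InnerProductSpace ℝ E]
    [FiniteDimensional ℝ E] [MeasurableSpace E] [BorelSpace E] (μ : Measure E) [μ.IsAddHaarMeasure]
    {h : E → E} (hh : ContDiff ℝ 1 h) {R : ℝ} (hR : ∀ x, R < ‖x‖ → h x = 0) (q : ℝ[X]) :
    ∫ x in closedBall 0 R, (1 + fderiv ℝ h x).det * q.eval (‖x + h x‖ ^ 2) ∂μ =
      ∫ x in closedBall 0 R, q.eval (‖x‖ ^ 2) ∂μ := by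
  obtain ⟨δ, hδ, hsmall⟩ :=
    exists_forall_integral_det_mul_eq μ hh hR fun x => q.eval (‖x‖ ^ 2)
  let G : ℝ → E → ℝ := fun t x => (1 + t • fderiv ℝ h x).det * q.eval (‖x + t • h x‖ ^ 2)
  have hpoly : ∀ x, ∃ p : ℝ[X], p.natDegree < Module.finrank ℝ E + q.natDegree * 2 + 1 ∧
      ∀ t, p.eval t = G t x := by
    intro x
    obtain ⟨p, hp, hpe⟩ := exists_polynomial_eval_eq_det (fderiv ℝ h x)
    let r : ℝ[X] := C (‖h x‖ ^ 2) * X ^ 2 + C (2 * inner ℝ x (h x)) * X + C (‖x‖ ^ 2)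
    have hr : r.natDegree ≤ 2 := natDegree_quadratic_le
    refine ⟨p * q.comp r, ?_, fun t => ?_⟩
    · refine Nat.lt_succ_of_le (natDegree_mul_le.trans (add_le_add hp ?_))
      exact natDegree_comp_le.trans (Nat.mul_le_mul_left _ hr)
    · rw [eval_mul, hpe, eval_comp]
      simp only [G, r, norm_add_sq_real, norm_smul, inner_smul_right, mul_pow, Real.norm_eq_abs,
        sq_abs, eval_add, eval_mul, eval_C, eval_pow, eval_X]
      ring_nf
  -- The nodes `δ / (i + 2)` lie in `(0, δ)`, where the change of variables formula is known.
  have hv : Function.Injective fun i : ℕ => δ / (i + 2) := by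
    intro i j hij
    have : (i : ℝ) + 2 = j + 2 := by
      simpa [div_eq_mul_inv, hδ.ne'] using hij
    exact_mod_cast add_right_cancel this
  obtain ⟨L, hL⟩ := exists_eval_eq_sum_mul_eval
    (n := Module.finrank ℝ E + q.natDegree * 2 + 1) hv 1
  -- The constant polynomial shows that the weights add up to one.
  have hL1 : ∑ i ∈ Finset.range (Module.finrank ℝ E + q.natDegree * 2 + 1), L i = 1 := by
    simpa using (hL 1 (by simp)).symm
  have hG : ∀ t, IntegrableOn (G t) (closedBall 0 R) μ := fun t => by
    refine ContinuousOn.integrableOn_compact (isCompact_closedBall 0 R)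
      (Continuous.continuousOn ?_)
    have h1 : Continuous (fderiv ℝ h) := hh.continuous_fderiv one_ne_zero
    have h2 : Continuous h := hh.continuous
    exact (ContinuousLinearMap.continuous_det.comp (by fun_prop)).mul
      (q.continuous.comp (by fun_prop))
  have h1 : ∀ x, G 1 x = ∑ i ∈ Finset.range (Module.finrank ℝ E + q.natDegree * 2 + 1),
      L i * G (δ / (i + 2)) x := fun x => by
    obtain ⟨p, hp, hpe⟩ := hpoly x
    simp_rw [← hpe]
    exact hL p hp
  calc ∫ x in closedBall 0 R, (1 + fderiv ℝ h x).det * q.eval (‖x + h x‖ ^ 2) ∂μ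
      = ∫ x in closedBall 0 R, G 1 x ∂μ := by simp [G]
    _ = ∑ i ∈ Finset.range (Module.finrank ℝ E + q.natDegree * 2 + 1),
          L i * ∫ x in closedBall 0 R, G (δ / (i + 2)) x ∂μ := by
        simp_rw [h1, ← integral_const_mul]
        exact integral_finsetSum _ fun i _ => (hG _).const_mul _
    _ = ∑ i ∈ Finset.range (Module.finrank ℝ E + q.natDegree * 2 + 1),
          L i * ∫ x in closedBall 0 R, q.eval (‖x‖ ^ 2) ∂μ := by
        refine Finset.sum_congr rfl fun i _ => ?_
        rw [hsmall (δ / (i + 2)) (by positivity)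
          (div_lt_self hδ (by linarith [i.cast_nonneg (α := ℝ)]))]
    _ = _ := by rw [← Finset.sum_mul, hL1, one_mul]

open MeasureTheory Metric Polynomial in
/-- A `C¹` map that is the identity outside a ball has a zero. Otherwise `‖x + h(x)‖² ≥ ε > 0`,
and the change of variables formula for a bump function `ψ(‖x‖²)` with `ψ` supported in
`u ≤ ε` reads `0 = ∫ ψ(‖x‖²) > 0`. -/
theorem exists_add_eq_zero_of_contDiff {E : Type*} [NormedAddCommGroup E] [InnerProductSpace ℝ E]
    [FiniteDimensional ℝ E] {h : E → E} (hh : ContDiff ℝ 1 h) {R : ℝ} (hR0 : 0 < R)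
    (hR : ∀ x, R < ‖x‖ → h x = 0) : ∃ x, x + h x = 0 := by
  by_contra! hne
  borelize E
  let μ : Measure E := Measure.addHaar
  have hcf : Continuous (fderiv ℝ h) := hh.continuous_fderiv one_ne_zero
  have hch : Continuous h := hh.continuous
  have hcd : Continuous fun x => (1 + fderiv ℝ h x).det :=
    ContinuousLinearMap.continuous_det.comp (by fun_prop)
  have hB : IsCompact (closedBall (0 : E) R) := isCompact_closedBall 0 R
  obtain ⟨x₀, -, hx₀⟩ := hB.exists_isMinOn ⟨0, by simp [hR0.le]⟩
    (f := fun x => ‖x + h x‖ ^ 2) (by fun_prop)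
  obtain ⟨x₁, -, hx₁⟩ := hB.exists_isMaxOn ⟨0, by simp [hR0.le]⟩
    (f := fun x => ‖x + h x‖ ^ 2) (by fun_prop)
  set ε := ‖x₀ + h x₀‖ ^ 2
  have hε : 0 < ε := by have := hne x₀; positivity
  let ψ : ℝ → ℝ := fun u => max 0 (ε - u)
  have hψ : Continuous ψ := by fun_prop
  have hcψ : Continuous fun x : E => ψ (‖x‖ ^ 2) := by fun_prop
  have hint : ∀ {f : E → ℝ}, Continuous f → IntegrableOn f (closedBall 0 R) μ := fun hf =>
    hf.continuousOn.integrableOn_compact hB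
  set I := ∫ x in closedBall 0 R, ψ (‖x‖ ^ 2) ∂μ
  set J := ∫ x in closedBall 0 R, (1 + |(1 + fderiv ℝ h x).det|) ∂μ
  have hJ : 0 ≤ J := integral_nonneg fun x => by positivity
  have hI : 0 < I := by
    refine (setIntegral_pos_iff_support_of_nonneg_ae (ae_of_all _ fun x => le_max_left _ _)
      (hint hcψ)).2 ?_
    have hsub : ball (0 : E) (min R (√ε)) ⊆
        (Function.support fun x : E => ψ (‖x‖ ^ 2)) ∩ closedBall 0 R := by
      intro x hx
      rw [mem_ball_zero_iff, lt_min_iff] at hx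
      refine ⟨?_, by simpa using hx.1.le⟩
      have : ‖x‖ ^ 2 < ε := by
        rw [← Real.sq_sqrt hε.le]
        exact pow_lt_pow_left₀ hx.2 (norm_nonneg _) two_ne_zero
      exact (lt_max_of_lt_right (sub_pos.2 this)).ne'
    exact (measure_ball_pos μ 0 (lt_min hR0 (Real.sqrt_pos.2 hε))).trans_le (measure_mono hsub)
  -- The formula is known for polynomials only, so `ψ` is approximated by a polynomial within `δ`.
  have key : ∀ δ > 0, I ≤ δ * J := by
    intro δ hδ
    obtain ⟨q, hq⟩ := exists_polynomial_near_of_continuousOn 0 (max (R ^ 2) (‖x₁ + h x₁‖ ^ 2)) ψ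
      hψ.continuousOn δ hδ
    have hcq : Continuous fun u => q.eval u := q.continuous
    have h1 := integral_det_mul_eval_eq μ hh hR q
    have h2 : I = ∫ x in closedBall 0 R, (ψ (‖x‖ ^ 2) - q.eval (‖x‖ ^ 2) +
        (1 + fderiv ℝ h x).det * q.eval (‖x + h x‖ ^ 2)) ∂μ := by
      rw [integral_add (hint (by fun_prop)) (hint (by fun_prop)),
        integral_sub (hint (by fun_prop)) (hint (by fun_prop)), h1]
      ring
    rw [h2, ← integral_const_mul]
    refine setIntegral_mono_on (hint (by fun_prop)) (hint (by fun_prop))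
      measurableSet_closedBall fun x hx => ?_
    have a1 := abs_lt.1 <| hq (‖x‖ ^ 2) ⟨by positivity, le_max_of_le_left
      (pow_le_pow_left₀ (norm_nonneg _) (mem_closedBall_zero_iff.1 hx) 2)⟩
    have a2 := hq (‖x + h x‖ ^ 2) ⟨by positivity, le_max_of_le_right (hx₁ hx)⟩
    rw [show ψ (‖x + h x‖ ^ 2) = 0 from max_eq_left (sub_nonpos.2 (hx₀ hx)), sub_zero] at a2
    have a3 : (1 + fderiv ℝ h x).det * q.eval (‖x + h x‖ ^ 2) ≤
        |(1 + fderiv ℝ h x).det| * δ := by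
      refine (le_abs_self _).trans ?_
      rw [abs_mul]
      gcongr
    linarith
  have := key (I / (2 * (J + 1))) (by positivity)
  rw [div_mul_eq_mul_div, le_div_iff₀ (by positivity)] at this
  nlinarith

/-- Brouwer's theorem in a Euclidean space: approximate `-f`, cut off far from the origin, by a
`C¹` map `g` with compact support; a zero of `x + g(x)` is an approximate fixed point of `f` in a
fixed compact ball. -/
theorem exists_fixedPoint_of_bounded_euclidean {E : Type*} [NormedAddCommGroup E]
    [InnerProductSpace ℝ E] [FiniteDimensional ℝ E] {f : E → E} (hf : Continuous f) {R : ℝ}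
    (hR : ∀ x, ‖f x‖ ≤ R) : ∃ x, f x = x := by
  have hR0 : 0 ≤ R := (norm_nonneg _).trans (hR 0)
  obtain ⟨x₀, -, hx₀⟩ := (isCompact_closedBall (0 : E) (R + 1)).exists_isMinOn
    ⟨0, by simpa using by positivity⟩ (f := fun x => ‖x - f x‖) (by fun_prop)
  have key : ∀ ε > 0, ε < 1 → ‖x₀ - f x₀‖ ≤ ε := by
    intro ε hε hε1
    let χ : E → ℝ := fun x => max 0 (min 1 (R + 2 - ‖x‖))
    have hχ0 : ∀ x, 0 ≤ χ x := fun x => le_max_left _ _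
    have hχ1 : ∀ x, χ x ≤ 1 := fun x => max_le zero_le_one (min_le_left _ _)
    have hcf : Continuous fun x => -(χ x • f x) := by fun_prop
    obtain ⟨g, hg, hgd, hgs⟩ := hcf.exists_contDiff_approx 1 (continuous_const (y := ε))
      fun _ => hε
    obtain ⟨x, hx⟩ := exists_add_eq_zero_of_contDiff (R := R + 2) hg (by positivity) fun x hx => by
      by_contra h
      refine hgs (Function.mem_support.2 h) ?_
      have : χ x = 0 := max_eq_left ((min_le_right _ _).trans (by linarith))
      simp [this]
    have hgx : g x = -x := (neg_eq_of_add_eq_zero_right hx).symm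
    have hd := hgd x
    rw [hgx, dist_eq_norm] at hd
    have h1 : ‖χ x • f x‖ ≤ R := by
      rw [norm_smul, Real.norm_of_nonneg (hχ0 x)]
      exact (mul_le_of_le_one_left (norm_nonneg _) (hχ1 x)).trans (hR x)
    have h2 : ‖x‖ ≤ R + 1 := by
      calc ‖x‖ = ‖χ x • f x - (-x - -(χ x • f x))‖ := by congr 1; abel
        _ ≤ ‖χ x • f x‖ + ‖-x - -(χ x • f x)‖ := norm_sub_le _ _
        _ ≤ R + 1 := by linarith
    have h3 : χ x = 1 := by
      simp only [χ]
      rw [min_eq_left (by linarith), max_eq_right zero_le_one]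
    rw [h3, one_smul, neg_sub_neg, norm_sub_rev] at hd
    exact (hx₀ (by simpa using h2)).trans hd.le
  refine ⟨x₀, (sub_eq_zero.1 (norm_le_zero_iff.1 ?_)).symm⟩
  refine le_of_forall_gt_imp_ge_of_dense fun ε hε => ?_
  exact (key (min ε (1 / 2)) (by positivity) (by linarith [min_le_right ε (1 / 2)])).trans
    (min_le_left _ _)

/-- **Brouwer's fixed point theorem**, for bounded continuous self-maps of a finite-dimensional
space instead of self-maps of a ball. -/
theorem exists_fixedPoint_of_bounded {E : Type*} [NormedAddCommGroup E]
    [NormedSpace ℝ E] [FiniteDimensional ℝ E] {f : E → E} (hf : Continuous f) {R : ℝ}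
    (hR : ∀ x, ‖f x‖ ≤ R) : ∃ x, f x = x := by
  let e : E ≃L[ℝ] EuclideanSpace ℝ (Fin (Module.finrank ℝ E)) :=
    ContinuousLinearEquiv.ofFinrankEq (by simp)
  obtain ⟨x, hx⟩ := exists_fixedPoint_of_bounded_euclidean (f := fun x => e (f (e.symm x)))
    (by fun_prop) (R := ‖e.toContinuousLinearMap‖ * R) fun x =>
      (e.toContinuousLinearMap.le_opNorm (f (e.symm x))).trans
        (mul_le_mul_of_nonneg_left (hR _) (norm_nonneg _))
  exact ⟨e.symm x, by simpa using congrArg e.symm hx⟩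

/-! ### Schauder's fixed point theorem -/

/-- **Schauder's fixed point theorem**, for continuous self-maps of a whole normed space with
range in a compact set. -/
theorem exists_fixedPoint_of_range_subset_isCompact {E : Type*} [NormedAddCommGroup E]
    [NormedSpace ℝ E] {T : E → E} (hT : Continuous T) {K : Set E} (hK : IsCompact K)
    (hTK : ∀ x, T x ∈ K) : ∃ x, T x = x := by
  -- An `ε`-net of `K` yields the Schauder projection `y ↦ ∑ wᵢ(y) i / ∑ wᵢ(y)`, which moves points
  -- of `K` by at most `ε`; Brouwer's theorem is applied to the vector of its weights.
  have approx : ∀ ε > 0, ∃ x, ‖x - T x‖ ≤ ε := by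
    intro ε hε
    obtain ⟨s, -, hs⟩ := hK.elim_finite_subcover_image (b := Set.univ)
      (c := fun z => Metric.ball z ε) (fun _ _ => Metric.isOpen_ball)
      fun z _ => Set.mem_biUnion (Set.mem_univ z) (Metric.mem_ball_self hε)
    obtain ⟨hsf, hs⟩ := hs
    let ι := hsf.toFinset
    let w : ι → E → ℝ := fun i y => max 0 (ε - ‖y - i‖)
    have hw0 : ∀ i y, 0 ≤ w i y := fun i y => le_max_left _ _
    have hwc : ∀ i, Continuous (w i) := fun i => by fun_prop
    have hws : ∀ x, 0 < ∑ i, w i (T x) := by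
      intro x
      obtain ⟨z, hz, hxz⟩ := Set.mem_iUnion₂.1 (hs (hTK x))
      refine Finset.sum_pos' (fun i _ => hw0 i _)
        ⟨⟨z, by simpa [ι] using hz⟩, Finset.mem_univ _, ?_⟩
      exact lt_max_of_lt_right (sub_pos.2 (mem_ball_iff_norm.1 hxz))
    let S : (ι → ℝ) → E := fun v => ∑ i, v i • (i : E)
    have hSc : Continuous S := by fun_prop
    obtain ⟨v, hv⟩ := exists_fixedPoint_of_bounded
      (f := fun v : ι → ℝ => fun i => w i (T (S v)) / ∑ j, w j (T (S v)))
      (continuous_pi fun i => ((hwc i).comp (hT.comp hSc)).div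
        (continuous_finsetSum _ fun j _ => (hwc j).comp (hT.comp hSc)) fun v => (hws _).ne')
      (R := 1) fun v => (pi_norm_le_iff_of_nonneg zero_le_one).2 fun i => by
        rw [Real.norm_of_nonneg (div_nonneg (hw0 _ _) (hws _).le), div_le_one (hws _)]
        exact Finset.single_le_sum (f := fun j => w j (T (S v))) (fun j _ => hw0 j _)
          (Finset.mem_univ i)
    set y := T (S v)
    have hv' : ∀ i, v i = w i y / ∑ j, w j y := fun i => (congrFun hv i).symm
    have hv0 : ∀ i, 0 ≤ v i := fun i => by rw [hv']; exact div_nonneg (hw0 _ _) (hws _).le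
    have hv1 : ∑ i, v i = 1 := by
      simp_rw [hv', ← Finset.sum_div]
      exact div_self (hws _).ne'
    refine ⟨S v, ?_⟩
    have h1 : S v - y = ∑ i, v i • ((i : E) - y) := by
      simp_rw [smul_sub, Finset.sum_sub_distrib, ← Finset.sum_smul, hv1, one_smul, S]
    calc ‖S v - y‖ ≤ ∑ i, v i * ε := by
          rw [h1]
          refine norm_sum_le_of_le _ fun i _ => ?_
          rw [norm_smul, Real.norm_of_nonneg (hv0 i)]
          rcases le_or_gt ‖(i : E) - y‖ ε with h | h
          · exact mul_le_mul_of_nonneg_left h (hv0 i)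
          · have : w i y = 0 := max_eq_left (by rw [norm_sub_rev]; linarith)
            simp [hv', this]
      _ = ε := by rw [← Finset.sum_mul, hv1, one_mul]
  choose x hx using fun n : ℕ => approx (1 / (n + 1)) (by positivity)
  obtain ⟨z, -, φ, hφ, hz⟩ := hK.tendsto_subseq fun n => hTK (x n)
  have h0 : Filter.Tendsto (fun n => x (φ n) - T (x (φ n))) Filter.atTop (nhds 0) :=
    (squeeze_zero_norm hx tendsto_one_div_add_atTop_nhds_zero_nat).comp hφ.tendsto_atTop
  have hxz : Filter.Tendsto (fun n => x (φ n)) Filter.atTop (nhds z) := by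
    simpa using h0.add hz
  exact ⟨z, tendsto_nhds_unique ((hT.tendsto z).comp hxz) hz⟩

/-! ### The exponential and the resolvent -/

theorem expOp_zero {X : Type*} [NormedAddCommGroup X] [NormedSpace ℂ X] (A : X →L[ℂ] X) :
    expOp A 0 = 1 := by
  simp [expOp]

theorem expOp_add {X : Type*} [NormedAddCommGroup X] [NormedSpace ℂ X] [CompleteSpace X]
    (A : X →L[ℂ] X) (s t : ℝ) : expOp A (s + t) = expOp A s * expOp A t := by
  let _ : NormedAlgebra ℚ (X →L[ℂ] X) := NormedAlgebra.restrictScalars ℚ ℂ (X →L[ℂ] X)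
  rw [expOp, Complex.ofReal_add, add_smul]
  exact NormedSpace.exp_add_of_commute (((Commute.refl A).smul_left _).smul_right _)

theorem hasDerivAt_expOp {X : Type*} [NormedAddCommGroup X] [NormedSpace ℂ X] [CompleteSpace X]
    (A : X →L[ℂ] X) (t : ℝ) : HasDerivAt (expOp A) (A * expOp A t) t := by
  have h := hasDerivAt_exp_smul_const' (𝕂 := ℝ) A t
  have he : expOp A = fun u : ℝ => NormedSpace.exp (u • A) := by
    funext u
    rw [expOp, Complex.coe_smul]
  rw [he]
  exact h

theorem expOp_apply_of_eigenvector {X : Type*} [NormedAddCommGroup X] [NormedSpace ℂ X]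
    [CompleteSpace X] {A : X →L[ℂ] X} {z : ℂ} {v : X} (hv : A v = z • v) (t : ℝ) :
    expOp A t v = Complex.exp (t * z) • v := by
  have hpow : ∀ n : ℕ, (((t : ℂ) • A) ^ n) v = ((t : ℂ) * z) ^ n • v := by
    intro n
    induction n with
    | zero => simp
    | succ n ih =>
      rw [pow_succ', mul_apply_eq_comp, ih, map_smul]
      simp only [smul_apply, hv, smul_smul]
      ring_nf
  have h1 := (NormedSpace.exp_series_hasSum_exp' (𝕂 := ℂ) ((t : ℂ) • A)).mapL
    (ContinuousLinearMap.apply ℂ X v)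
  have h2 := (NormedSpace.exp_series_hasSum_exp' (𝕂 := ℂ) ((t : ℂ) * z)).smul_const v
  rw [← Complex.exp_eq_exp_ℂ] at h2
  refine h1.unique ?_
  convert h2 using 2 with n
  rw [ContinuousLinearMap.apply_apply, smul_apply, hpow, smul_smul, smul_eq_mul]

/-- The part of the spectral mapping theorem that is needed: the kernel of `c - e^{Aω}` is invariant
under `A`, so if it is nonzero, then it contains an eigenvector of `A`, whose eigenvalue `z`
satisfies `e^{ωz} = c`. -/
theorem isUnit_smul_one_sub_expOp {X : Type*} [NormedAddCommGroup X] [NormedSpace ℂ X]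
    [FiniteDimensional ℂ X] {A : X →L[ℂ] X} {ω : ℝ} {c : ℂ}
    (hA : ∀ z ∈ spectrum ℂ A, c ≠ Complex.exp (ω * z)) :
    IsUnit (c • (1 : X →L[ℂ] X) - expOp A ω) := by
  have : CompleteSpace X := FiniteDimensional.complete ℂ X
  by_contra hu
  let S : X →L[ℂ] X := c • 1 - expOp A ω
  have hcomm : Commute A S := by
    refine ((Commute.one_right A).smul_right c).sub_right ?_
    exact ((Commute.refl A).smul_right _).exp_right
  let N : Submodule ℂ X := LinearMap.ker (S : X →ₗ[ℂ] X)
  have hN : N ≠ ⊥ := by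
    intro h
    refine hu (ContinuousLinearMap.isUnit_iff_isUnit_toLinearMap.2 ?_)
    exact (LinearMap.isUnit_iff_ker_eq_bot _).2 h
  have hinv : ∀ x ∈ N, A x ∈ N := by
    intro x hx
    have hx' : S x = 0 := hx
    change S (A x) = 0
    rw [← mul_apply_eq_comp, ← hcomm.eq, mul_apply_eq_comp, hx', map_zero]
  have : Nontrivial N := (Submodule.nontrivial_iff_ne_bot).2 hN
  obtain ⟨z, hz⟩ := Module.End.exists_eigenvalue ((A : X →ₗ[ℂ] X).restrict hinv)
  obtain ⟨v, hv, hv0⟩ := hz.exists_hasEigenvector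
  have hAv : A v = z • (v : X) := congrArg Subtype.val (Module.End.mem_eigenspace_iff.1 hv)
  have hv0' : (v : X) ≠ 0 := by simpa using hv0
  have hSv : S v = 0 := v.2
  have hzA : z ∈ spectrum ℂ A := by
    rw [spectrum.mem_iff]
    intro hz
    obtain ⟨u, hu⟩ := hz
    apply hv0'
    have h1 : (u : X →L[ℂ] X) v = 0 := by
      rw [hu]; simp [Algebra.algebraMap_eq_smul_one, hAv]
    have h2 : (↑u⁻¹ : X →L[ℂ] X) ((u : X →L[ℂ] X) v) = v :=
      congrArg (fun T : X →L[ℂ] X => T v) u.inv_mul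
    rw [← h2, h1, map_zero]
  refine hA z hzA ?_
  have h3 : c • (v : X) - Complex.exp (ω * z) • (v : X) = 0 := by
    rw [← expOp_apply_of_eigenvector hAv ω]
    simpa [S] using hSv
  rw [← sub_smul, smul_eq_zero] at h3
  exact sub_eq_zero.1 (h3.resolve_right hv0')

theorem expOp_mul_resolventOp_add_one {X : Type*} [NormedAddCommGroup X] [NormedSpace ℂ X]
    {A : X →L[ℂ] X} {ω : ℝ} {c : ℂ} (hu : IsUnit (c • (1 : X →L[ℂ] X) - expOp A ω)) :
    expOp A ω * resolventOp A ω c + 1 = c • resolventOp A ω c := by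
  have h : (c • (1 : X →L[ℂ] X) - expOp A ω) * resolventOp A ω c = 1 :=
    Ring.mul_inverse_cancel _ hu
  rw [← h, sub_mul, smul_mul_assoc, one_mul, add_sub_cancel]

/-! ### Variation of constants with the boundary condition `u(ω) = c u(0)` -/

/-- The solution `u(t) = e^{At} (b + ∫₀ᵗ e^{-As} f(s) ds)` of `u' = Au + f` whose initial value
`b = e^{Aω} (cI - e^{Aω})⁻¹ ∫₀^ω e^{-As} f(s) ds` makes `u(ω) = c u(0)`. It is defined for all
real times; on `[0, ω]` it is the integral of `f` against the Green kernel. -/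
noncomputable def greenSolution {X : Type*} [NormedAddCommGroup X] [NormedSpace ℂ X]
    (A : X →L[ℂ] X) (ω : ℝ) (c : ℂ) (f : ℝ → X) (t : ℝ) : X :=
  expOp A t (expOp A ω (resolventOp A ω c (∫ s in (0 : ℝ)..ω, expOp A (-s) (f s))) +
    ∫ s in (0 : ℝ)..t, expOp A (-s) (f s))

/-- The boundary condition on `[0, ω]`, which does not require `f` to be `(ω, c)`-periodic. -/
theorem greenSolution_period {X : Type*} [NormedAddCommGroup X] [NormedSpace ℂ X]
    {A : X →L[ℂ] X} {ω : ℝ} {c : ℂ} {f : ℝ → X} (hu : IsUnit (c • (1 : X →L[ℂ] X) - expOp A ω)) :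
    greenSolution A ω c f ω = c • greenSolution A ω c f 0 := by
  set F := ∫ s in (0 : ℝ)..ω, expOp A (-s) (f s) with hF
  have h4 : expOp A ω (resolventOp A ω c F) + F = c • resolventOp A ω c F :=
    congrArg (fun T : X →L[ℂ] X => T F) (expOp_mul_resolventOp_add_one hu)
  simp [greenSolution, ← hF, h4, expOp_zero]

section
variable {X : Type*} [NormedAddCommGroup X] [NormedSpace ℂ X] [CompleteSpace X]
  {A : X →L[ℂ] X} {ω : ℝ} {c : ℂ} {f : ℝ → X}

theorem continuous_expOp_neg_apply (A : X →L[ℂ] X) (hf : Continuous f) :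
    Continuous fun s => expOp A (-s) (f s) :=
  ((continuous_expOp A).comp continuous_neg).clm_apply hf

theorem expOp_mul_expOp_neg (A : X →L[ℂ] X) (t : ℝ) : expOp A t * expOp A (-t) = 1 := by
  rw [← expOp_add, add_neg_cancel, expOp_zero]

theorem hasDerivAt_greenSolution (hf : Continuous f) (t : ℝ) :
    HasDerivAt (greenSolution A ω c f) (A (greenSolution A ω c f t) + f t) t := by
  have hc := continuous_expOp_neg_apply A hf
  have h1 : HasDerivAt (fun t => ∫ s in (0 : ℝ)..t, expOp A (-s) (f s)) (expOp A (-t) (f t)) t :=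
    intervalIntegral.integral_hasDerivAt_right (hc.intervalIntegrable _ _)
      (hc.stronglyMeasurableAtFilter _ _) hc.continuousAt
  have h2 := ((ContinuousLinearMap.restrictScalarsL ℂ X X ℝ ℝ).hasFDerivAt.comp_hasDerivAt t
    (hasDerivAt_expOp A t)).clm_apply (h1.const_add
      (expOp A ω (resolventOp A ω c (∫ s in (0 : ℝ)..ω, expOp A (-s) (f s)))))
  refine h2.congr_deriv ?_
  have h3 : expOp A t (expOp A (-t) (f t)) = f t := by
    rw [← mul_apply_eq_comp, expOp_mul_expOp_neg, one_apply_eq_self]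
  simp [greenSolution, h3]

/-- If `f` is `(ω, c)`-periodic on the whole line, then so is the solution. -/
theorem greenSolution_add_period (hu : IsUnit (c • (1 : X →L[ℂ] X) - expOp A ω))
    (hf : Continuous f) (hfp : ∀ t, f (t + ω) = c • f t) (t : ℝ) :
    greenSolution A ω c f (t + ω) = c • greenSolution A ω c f t := by
  have hc := continuous_expOp_neg_apply A hf
  set F := ∫ s in (0 : ℝ)..ω, expOp A (-s) (f s) with hF
  have h1 : ∫ s in (0 : ℝ)..(t + ω), expOp A (-s) (f s) =
      F + c • expOp A (-ω) (∫ s in (0 : ℝ)..t, expOp A (-s) (f s)) := by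
    rw [← intervalIntegral.integral_add_adjacent_intervals (hc.intervalIntegrable 0 ω)
      (hc.intervalIntegrable ω (t + ω)), ← hF]
    congr 1
    have h2 := intervalIntegral.integral_comp_add_right (a := 0) (b := t)
      (fun s => expOp A (-s) (f s)) ω
    rw [zero_add] at h2
    rw [← h2, ← smul_apply]
    rw [← ContinuousLinearMap.intervalIntegral_comp_comm _ (hc.intervalIntegrable 0 t)]
    refine intervalIntegral.integral_congr fun s _ => ?_
    simp only [hfp]
    rw [neg_add_rev, expOp_add]
    simp
  have h4 : expOp A ω (resolventOp A ω c F) + F = c • resolventOp A ω c F :=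
    congrArg (fun T : X →L[ℂ] X => T F) (expOp_mul_resolventOp_add_one hu)
  have h5 : ∀ x, expOp A ω (expOp A (-ω) x) = x := fun x =>
    congrArg (fun T : X →L[ℂ] X => T x) (expOp_mul_expOp_neg A ω)
  simp only [greenSolution]
  rw [← hF, h1, ← add_assoc, h4, expOp_add, mul_apply_eq_comp, map_add, map_smul,
    map_smul, h5, ← smul_add, map_smul]

theorem commute_expOp_resolventOp (hu : IsUnit (c • (1 : X →L[ℂ] X) - expOp A ω)) (s : ℝ) :
    Commute (expOp A s) (resolventOp A ω c) := by
  have h : Commute (expOp A s) (expOp A ω) := by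
    rw [Commute, SemiconjBy, ← expOp_add, ← expOp_add, add_comm]
  have h' : Commute (expOp A s) (c • (1 : X →L[ℂ] X) - expOp A ω) :=
    ((Commute.one_right _).smul_right c).sub_right h
  obtain ⟨u, hu⟩ := hu
  rw [← hu] at h'
  rw [resolventOp, ← hu, Ring.inverse_unit]
  exact h'.units_inv_right

theorem greenSolution_eq_integral (hu : IsUnit (c • (1 : X →L[ℂ] X) - expOp A ω))
    (hf : Continuous f) {t : ℝ} (ht : t ∈ Set.Icc 0 ω) :
    IntervalIntegrable (fun s => greenKernel A ω c t s (f s)) MeasureTheory.volume 0 ω ∧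
    greenSolution A ω c f t = ∫ s in (0 : ℝ)..ω, greenKernel A ω c t s (f s) := by
  have hc := continuous_expOp_neg_apply A hf
  let P : X →L[ℂ] X := c • (expOp A t * resolventOp A ω c)
  let Q : X →L[ℂ] X := expOp A (ω + t) * resolventOp A ω c
  have e1 : ∀ s, s ≤ t → greenKernel A ω c t s = P * expOp A (-s) := fun s hs => by
    rw [greenKernel, if_pos hs, sub_eq_add_neg, expOp_add, mul_assoc,
      (commute_expOp_resolventOp hu (-s)).eq, smul_mul_assoc, mul_assoc]
  have e2 : ∀ s, t < s → greenKernel A ω c t s = Q * expOp A (-s) := fun s hs => by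
    rw [greenKernel, if_neg hs.not_ge, sub_eq_add_neg, expOp_add, mul_assoc,
      (commute_expOp_resolventOp hu (-s)).eq, mul_assoc]
  have c1 : Set.EqOn (fun s => P (expOp A (-s) (f s))) (fun s => greenKernel A ω c t s (f s))
      (Set.uIoc 0 t) := fun s hs => by
    rw [Set.uIoc_of_le ht.1] at hs
    simp [e1 s hs.2]
  have c2 : Set.EqOn (fun s => Q (expOp A (-s) (f s))) (fun s => greenKernel A ω c t s (f s))
      (Set.uIoc t ω) := fun s hs => by
    rw [Set.uIoc_of_le ht.2] at hs
    simp [e2 s hs.1]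
  have i1 := ((P.continuous.comp hc).intervalIntegrable (μ := MeasureTheory.volume) 0 t).congr c1
  have i2 := ((Q.continuous.comp hc).intervalIntegrable (μ := MeasureTheory.volume) t ω).congr c2
  refine ⟨i1.trans i2, ?_⟩
  rw [← intervalIntegral.integral_add_adjacent_intervals i1 i2,
    ← intervalIntegral.integral_congr_ae (Filter.Eventually.of_forall fun s hs => c1 hs),
    ← intervalIntegral.integral_congr_ae (Filter.Eventually.of_forall fun s hs => c2 hs),
    ContinuousLinearMap.intervalIntegral_comp_comm _ (hc.intervalIntegrable _ _),
    ContinuousLinearMap.intervalIntegral_comp_comm _ (hc.intervalIntegrable _ _)]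
  have hs := intervalIntegral.integral_add_adjacent_intervals
    (hc.intervalIntegrable (μ := MeasureTheory.volume) 0 t) (hc.intervalIntegrable t ω)
  set G := ∫ s in (0 : ℝ)..t, expOp A (-s) (f s) with hG
  set H := ∫ s in t..ω, expOp A (-s) (f s) with hH
  have hE := congrArg (fun T : X →L[ℂ] X => expOp A t (T G)) (expOp_mul_resolventOp_add_one hu)
  simp only [add_apply, mul_apply_eq_comp,
    one_apply_eq_self, smul_apply, map_add, map_smul] at hE
  simp only [greenSolution, ← hs, ← hG, P, Q, add_comm ω t, expOp_add,
    mul_apply_eq_comp, map_add, smul_apply, ← hE]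
  abel

theorem norm_greenSolution_le (hω : 0 < ω) (hu : IsUnit (c • (1 : X →L[ℂ] X) - expOp A ω))
    (hf : Continuous f) {C : ℝ} (hC : ∀ s ∈ Set.Icc 0 ω, ‖f s‖ ≤ C) {t : ℝ}
    (ht : t ∈ Set.Icc 0 ω) : ‖greenSolution A ω c f t‖ ≤ greenBound A ω c * C := by
  have hC0 : 0 ≤ C := (norm_nonneg _).trans (hC t ht)
  have hK := integral_norm_greenKernel A c ht
  have hM := (isGreatest_greenBound A hω c).2 ⟨t, ht, rfl⟩
  rw [(greenSolution_eq_integral hu hf ht).2]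
  calc ‖∫ s in (0 : ℝ)..ω, greenKernel A ω c t s (f s)‖
      ≤ ∫ s in (0 : ℝ)..ω, ‖greenKernel A ω c t s‖ * C := by
        refine intervalIntegral.norm_integral_le_of_norm_le hω.le ?_ (hK.1.mul_const C)
        refine Filter.Eventually.of_forall fun s hs => ?_
        exact (ContinuousLinearMap.le_opNorm _ _).trans
          (mul_le_mul_of_nonneg_left (hC s ⟨hs.1.le, hs.2⟩) (norm_nonneg _))
    _ = (∫ s in (0 : ℝ)..ω, ‖greenKernel A ω c t s‖) * C :=
        intervalIntegral.integral_mul_const _ _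
    _ ≤ _ := mul_le_mul_of_nonneg_right hM hC0

theorem greenBound_nonneg (hω : 0 < ω) : 0 ≤ greenBound A ω c :=
  (intervalIntegral.integral_nonneg hω.le fun _ _ => norm_nonneg _).trans
    ((isGreatest_greenBound A hω c).2 ⟨0, ⟨le_rfl, hω.le⟩, rfl⟩)

theorem greenSolution_sub {f₁ f₂ : ℝ → X} (h₁ : Continuous f₁) (h₂ : Continuous f₂) (t : ℝ) :
    greenSolution A ω c (fun s => f₁ s - f₂ s) t =
      greenSolution A ω c f₁ t - greenSolution A ω c f₂ t := by
  have c₁ := continuous_expOp_neg_apply A h₁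
  have c₂ := continuous_expOp_neg_apply A h₂
  simp only [greenSolution, map_sub]
  rw [intervalIntegral.integral_sub (c₁.intervalIntegrable _ _) (c₂.intervalIntegrable _ _),
    intervalIntegral.integral_sub (c₁.intervalIntegrable _ _) (c₂.intervalIntegrable _ _)]
  simp only [map_sub, map_add]
  abel

end

theorem greenSolution_congr {X : Type*} [NormedAddCommGroup X] [NormedSpace ℂ X]
    {A : X →L[ℂ] X} {ω : ℝ} {c : ℂ} {f₁ f₂ : ℝ → X} (h : Set.EqOn f₁ f₂ (Set.Icc 0 ω)) {t : ℝ}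
    (ht : t ∈ Set.Icc 0 ω) : greenSolution A ω c f₁ t = greenSolution A ω c f₂ t := by
  have hint : ∀ r ∈ Set.Icc 0 ω, ∫ s in (0 : ℝ)..r, expOp A (-s) (f₁ s) =
      ∫ s in (0 : ℝ)..r, expOp A (-s) (f₂ s) := fun r hr => by
    refine intervalIntegral.integral_congr fun s hs => ?_
    rw [Set.uIcc_of_le hr.1] at hs
    simp only [h ⟨hs.1, hs.2.trans hr.2⟩]
  simp only [greenSolution, hint t ht, hint ω ⟨ht.1.trans ht.2, le_rfl⟩]

/-! ### Extension of functions from `[0, ω]` to the line -/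

/-- A continuous function on `[0, ω]` with `y(ω) = c y(0)` extends to a continuous `(ω, c)`-periodic
function on the line: divided by `e^{μt}`, where `e^{μω} = c`, it descends to the circle. -/
theorem exists_continuous_extension_period {X : Type*} [NormedAddCommGroup X] [NormedSpace ℂ X]
    {ω : ℝ} (hω : 0 < ω) {c : ℂ} (hc : c ≠ 0) {y : ℝ → X} (hy : ContinuousOn y (Set.Icc 0 ω))
    (hyp : y ω = c • y 0) :
    ∃ Y : C(ℝ, X), (∀ t, Y (t + ω) = c • Y t) ∧ ∀ t ∈ Set.Icc 0 ω, Y t = y t := by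
  let m : ℝ → ℂ := fun t => Complex.exp (t / ω * Complex.log c)
  have hω' : (ω : ℂ) ≠ 0 := Complex.ofReal_ne_zero.2 hω.ne'
  have hmc : Continuous m := by fun_prop
  have hm0 : ∀ t, m t ≠ 0 := fun t => Complex.exp_ne_zero _
  have hmp : ∀ t, m (t + ω) = c * m t := fun t => by
    simp only [m, Complex.ofReal_add, add_div, div_self hω', add_mul, one_mul, Complex.exp_add,
      Complex.exp_log hc, mul_comm c]
  let z : ℝ → X := fun t => (m t)⁻¹ • y t
  have hz : z 0 = z ω := by
    have := hmp 0
    rw [zero_add] at this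
    simp only [z, hyp, this, smul_smul]
    congr 1
    field_simp
  have hzc : ContinuousOn z (Set.Icc 0 ω) := (hmc.inv₀ hm0).continuousOn.smul hy
  have : Fact (0 < ω) := ⟨hω⟩
  let Z : AddCircle ω → X := AddCircle.liftIco ω 0 z
  have hZ : Continuous Z := AddCircle.liftIco_zero_continuous hz hzc
  have hY : ∀ t ∈ Set.Ico 0 ω, m t • Z t = y t := fun t ht => by
    simp only [Z, AddCircle.liftIco_zero_coe_apply ht, z]
    rw [smul_inv_smul₀ (hm0 t)]
  have hYp : ∀ t : ℝ, m (t + ω) • Z ((t + ω : ℝ) : AddCircle ω) = c • m t • Z t := fun t => by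
    rw [AddCircle.coe_add_period, hmp, mul_smul]
  refine ⟨⟨fun t => m t • Z t, hmc.smul (hZ.comp (AddCircle.continuous_mk' ω))⟩, hYp,
    fun t ht => ?_⟩
  rcases ht.2.lt_or_eq with h | rfl
  · exact hY t ⟨ht.1, h⟩
  · have := hYp 0
    rw [zero_add, hY 0 ⟨le_rfl, hω⟩, ← hyp] at this
    exact this

theorem eq_of_eqOn_Icc_of_period {X : Type*} [AddCommGroup X] [Module ℂ X]
    {ω : ℝ} (hω : 0 < ω) {c : ℂ} (hc : c ≠ 0) {u v : ℝ → X} (hu : ∀ t, u (t + ω) = c • u t)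
    (hv : ∀ t, v (t + ω) = c • v t) (h : Set.EqOn u v (Set.Icc 0 ω)) : u = v := by
  have hp : Function.Periodic (fun t => u t = v t) ω := fun t => by
    simp only [hu, hv, smul_right_inj hc]
  funext t
  obtain ⟨s, hs, hst⟩ := hp.exists_mem_Ico₀ hω t
  exact hst.mpr (h ⟨hs.1, hs.2.le⟩)

/-! ### Radial retraction and compactness -/

/-- The radial retraction onto the closed ball of radius `R > 0` about the origin. -/
noncomputable def ballRetraction {E : Type*} [NormedAddCommGroup E] [NormedSpace ℝ E]
    (R : ℝ) (x : E) : E :=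
  (max 1 (‖x‖ / R))⁻¹ • x

section
variable {E : Type*} [NormedAddCommGroup E] [NormedSpace ℝ E] {R : ℝ}

theorem continuous_ballRetraction : Continuous (ballRetraction R : E → E) := by
  have h : Continuous fun x : E => max 1 (‖x‖ / R) := by fun_prop
  exact (h.inv₀ fun x => (zero_lt_one.trans_le (le_max_left _ _)).ne').smul continuous_id

theorem ballRetraction_of_norm_le (hR : 0 < R) {x : E} (hx : ‖x‖ ≤ R) :
    ballRetraction R x = x := by
  rw [ballRetraction, max_eq_left ((div_le_one hR).2 hx), inv_one, one_smul]

theorem norm_ballRetraction_le (hR : 0 < R) (x : E) : ‖ballRetraction R x‖ ≤ R := by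
  have h : 0 < max 1 (‖x‖ / R) := zero_lt_one.trans_le (le_max_left _ _)
  rw [ballRetraction, norm_smul, norm_inv, Real.norm_of_nonneg h.le, inv_mul_le_iff₀ h]
  calc ‖x‖ = ‖x‖ / R * R := by field_simp
    _ ≤ _ := mul_le_mul_of_nonneg_right (le_max_right _ _) hR.le

end

/-- A form of the Arzelà–Ascoli theorem. -/
theorem isCompact_setOf_norm_le_of_lipschitz {α X : Type*} [PseudoMetricSpace α] [CompactSpace α]
    [NormedAddCommGroup X] [ProperSpace X] (R : ℝ) (L : NNReal) :
    IsCompact {u : C(α, X) | (∀ t, ‖u t‖ ≤ R) ∧ LipschitzWith L u} := by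
  refine ArzelaAscoli.isCompact_of_equicontinuous _ ?_ ?_
  · have hS : ContinuousMap.toFun '' {u : C(α, X) | (∀ t, ‖u t‖ ≤ R) ∧ LipschitzWith L u} =
        Set.univ.pi (fun _ => Metric.closedBall (0 : X) R) ∩
          {f : α → X | LipschitzWith L f} := by
      ext f
      constructor
      · rintro ⟨u, ⟨h1, h2⟩, rfl⟩
        exact ⟨fun t _ => mem_closedBall_zero_iff.2 (h1 t), h2⟩
      · rintro ⟨h1, h2⟩
        exact ⟨⟨f, h2.continuous⟩, ⟨fun t => mem_closedBall_zero_iff.1 (h1 t trivial), h2⟩, rfl⟩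
    rw [hS]
    refine (isCompact_univ_pi fun _ => isCompact_closedBall 0 R).inter_right ?_
    exact isClosed_setOfPred_lipschitzWith L
  · exact (LipschitzWith.uniformEquicontinuous _ L fun u => u.2.2).equicontinuous


/-! ### The fixed point equation on `[0, ω]` -/

/-- The operator `f ↦ ∫₀^ω K(·, s) f(s) ds` on `C([0, ω], X)`, through `greenSolution`. The
values of the extension of `f` outside `[0, ω]` play no role. -/
noncomputable def greenOperator {X : Type*} [NormedAddCommGroup X] [NormedSpace ℂ X]
    [CompleteSpace X] (A : X →L[ℂ] X) {ω : ℝ} (hω : 0 < ω) (c : ℂ) (f : C(Set.Icc 0 ω, X)) :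
    C(Set.Icc 0 ω, X) where
  toFun t := greenSolution A ω c (Set.IccExtend hω.le f) t
  continuous_toFun := (continuous_iff_continuousAt.2 fun t =>
    (hasDerivAt_greenSolution f.continuous.Icc_extend' t).continuousAt).comp continuous_subtype_val

section
variable {X : Type*} [NormedAddCommGroup X] [NormedSpace ℂ X] [CompleteSpace X]
  {A : X →L[ℂ] X} {ω : ℝ} {c : ℂ}

theorem norm_greenOperator_apply_le (hω : 0 < ω)
    (hu : IsUnit (c • (1 : X →L[ℂ] X) - expOp A ω)) (f : C(Set.Icc 0 ω, X)) (t : Set.Icc 0 ω) :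
    ‖greenOperator A hω c f t‖ ≤ greenBound A ω c * ‖f‖ :=
  norm_greenSolution_le hω hu f.continuous.Icc_extend' (fun _ _ => f.norm_coe_le_norm _) t.2

theorem continuous_greenOperator (hω : 0 < ω)
    (hu : IsUnit (c • (1 : X →L[ℂ] X) - expOp A ω)) : Continuous (greenOperator A hω c) := by
  refine (LipschitzWith.of_dist_le_mul (K := (greenBound A ω c).toNNReal)
    fun f₁ f₂ => ?_).continuous
  rw [Real.coe_toNNReal _ (greenBound_nonneg hω), dist_eq_norm, dist_eq_norm]
  refine (ContinuousMap.norm_le _ (mul_nonneg (greenBound_nonneg hω) (norm_nonneg _))).2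
    fun t => ?_
  have h : (greenOperator A hω c f₁ - greenOperator A hω c f₂) t =
      greenOperator A hω c (f₁ - f₂) t :=
    (greenSolution_sub f₁.continuous.Icc_extend' f₂.continuous.Icc_extend' _).symm
  rw [h]
  exact norm_greenOperator_apply_le hω hu _ t

theorem lipschitzWith_greenOperator_apply (hω : 0 < ω)
    (hu : IsUnit (c • (1 : X →L[ℂ] X) - expOp A ω)) (f : C(Set.Icc 0 ω, X)) {C : ℝ}
    (hf : ‖f‖ ≤ C) :
    LipschitzWith (‖A‖ * (greenBound A ω c * C) + C).toNNReal (greenOperator A hω c f) := by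
  have hM := greenBound_nonneg (A := A) (c := c) hω
  have hC : 0 ≤ C := (norm_nonneg _).trans hf
  refine LipschitzWith.of_dist_le_mul fun s t => ?_
  rw [Real.coe_toNNReal _ (by positivity), dist_eq_norm, Subtype.dist_eq, dist_eq_norm]
  refine Convex.norm_image_sub_le_of_norm_hasDerivWithin_le (s := Set.Icc 0 ω)
    (fun r _ => (hasDerivAt_greenSolution f.continuous.Icc_extend' r).hasDerivWithinAt)
    (fun r hr => ?_) (convex_Icc 0 ω) t.2 s.2
  refine (norm_add_le _ _).trans (add_le_add ((A.le_opNorm _).trans ?_)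
    ((f.norm_coe_le_norm _).trans hf))
  gcongr
  exact (norm_greenOperator_apply_le hω hu f ⟨r, hr⟩).trans
    (mul_le_mul_of_nonneg_left hf hM)

end

/-- The superposition (Nemytskii) operator `y ↦ g(·, y(·))` on `C(s, X)`. -/
def superposition {X : Type*} [TopologicalSpace X] {g : ℝ × X → X} (hg : Continuous g) (s : Set ℝ)
    (y : C(s, X)) : C(s, X) where
  toFun t := g (t, y t)
  continuous_toFun := by fun_prop

theorem continuous_superposition {X : Type*} [TopologicalSpace X] {g : ℝ × X → X}
    (hg : Continuous g) (s : Set ℝ) [LocallyCompactSpace s] : Continuous (superposition hg s) := by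
  refine ContinuousMap.continuous_of_continuous_uncurry _ ?_
  have h : Continuous fun p : C(s, X) × s => p.1 p.2 := by fun_prop
  exact hg.comp ((continuous_subtype_val.comp continuous_snd).prodMk h)

/-- Schauder's theorem on `C([0, ω], X)`. It yields a fixed point of the operator composed with the
retraction onto a ball that the operator maps to itself; such a fixed point lies in the ball, so
the retraction does not affect it. -/
theorem exists_greenOperator_superposition_eq {X : Type*} [NormedAddCommGroup X] [NormedSpace ℂ X]
    [FiniteDimensional ℂ X] [CompleteSpace X] {A : X →L[ℂ] X} {ω : ℝ} (hω : 0 < ω) {c : ℂ}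
    (hu : IsUnit (c • (1 : X →L[ℂ] X) - expOp A ω)) {g : ℝ × X → X} (hg : Continuous g)
    {g₁ g₂ : ℝ} (hg₁ : 0 ≤ g₁) (hg₂ : 0 ≤ g₂) (hgb : ∀ t y, ‖g (t, y)‖ ≤ g₁ + g₂ * ‖y‖)
    (hM : g₂ * greenBound A ω c < 1) :
    ∃ y : C(Set.Icc 0 ω, X), greenOperator A hω c (superposition hg _ y) = y ∧
      ‖y‖ ≤ greenBound A ω c * g₁ / (1 - greenBound A ω c * g₂) := by
  have : ProperSpace X := FiniteDimensional.proper ℂ X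
  set M := greenBound A ω c with hMdef
  have hM0 : 0 ≤ M := greenBound_nonneg hω
  have hd : 0 < 1 - M * g₂ := by linarith [mul_comm M g₂]
  -- The summand `1` keeps the radius positive; the sharp bound follows from the fixed point equation.
  let R := M * g₁ / (1 - M * g₂) + 1
  have hR : 0 < R := by positivity
  have hMR : M * (g₁ + g₂ * R) ≤ R := by
    have h : M * g₁ / (1 - M * g₂) * (1 - M * g₂) = M * g₁ := div_mul_cancel₀ _ hd.ne'
    simp only [R]
    nlinarith
  have hsup : ∀ y : C(Set.Icc 0 ω, X), ‖superposition hg _ y‖ ≤ g₁ + g₂ * ‖y‖ := fun y =>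
    (ContinuousMap.norm_le _ (by positivity)).2 fun t => (hgb _ _).trans
      (by gcongr; exact y.norm_coe_le_norm t)
  have hsupR : ∀ y : C(Set.Icc 0 ω, X),
      ‖superposition hg _ (ballRetraction R y)‖ ≤ g₁ + g₂ * R := fun y =>
    (hsup _).trans (by gcongr; exact norm_ballRetraction_le hR y)
  obtain ⟨y, hy⟩ := exists_fixedPoint_of_range_subset_isCompact
    (T := fun y => greenOperator A hω c (superposition hg _ (ballRetraction R y)))
    ((continuous_greenOperator hω hu).comp
      ((continuous_superposition hg _).comp continuous_ballRetraction))
    (isCompact_setOf_norm_le_of_lipschitz (M * (g₁ + g₂ * R)) _)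
    fun y => ⟨fun t => (norm_greenOperator_apply_le hω hu _ t).trans
      (mul_le_mul_of_nonneg_left (hsupR y) hM0),
      lipschitzWith_greenOperator_apply hω hu _ (hsupR y)⟩
  have hyR : ‖y‖ ≤ R := by
    refine le_trans ?_ hMR
    rw [← hy]
    exact (ContinuousMap.norm_le _ (by positivity)).2 fun t =>
      (norm_greenOperator_apply_le hω hu _ t).trans (mul_le_mul_of_nonneg_left (hsupR y) hM0)
  simp only [ballRetraction_of_norm_le hR hyR] at hy
  refine ⟨y, hy, ?_⟩
  have hyM : ‖y‖ ≤ M * (g₁ + g₂ * ‖y‖) := by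
    conv_lhs => rw [← hy]
    exact (ContinuousMap.norm_le _ (by positivity)).2 fun t =>
      (norm_greenOperator_apply_le hω hu _ t).trans (mul_le_mul_of_nonneg_left (hsup y) hM0)
  rw [le_div_iff₀ hd]
  linarith

/-! ### The periodic solution -/

theorem theorem2 {X : Type*} [NormedAddCommGroup X] [NormedSpace ℂ X] [FiniteDimensional ℂ X]
    (A : X →L[ℂ] X) (ω : ℝ) (hω : 0 < ω) (c : ℂ) (hc : c ≠ 0)
    (hA1 : ∀ z ∈ spectrum ℂ A, c ≠ Complex.exp ((ω : ℂ) * z))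
    (g : ℝ × X → X) (hg : Continuous g)
    (hC1 : ∀ (t : ℝ) (y : X), g (t + ω, c • y) = c • g (t, y))
    (g₁ g₂ : ℝ) (hg₁ : 0 ≤ g₁) (hg₂ : 0 ≤ g₂)
    (hC3 : ∀ (t : ℝ) (y : X), ‖g (t, y)‖ ≤ g₁ + g₂ * ‖y‖)
    (hM : g₂ * greenBound A ω c < 1) :
    ∃ y : C(ℝ, X), IsOmegaCPeriodic ω c y ∧
      (∀ t : ℝ, HasDerivAt y (A (y t) + g (t, y t)) t) ∧
      ‖y.restrict (Set.Icc 0 ω)‖ ≤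
        greenBound A ω c * g₁ / (1 - greenBound A ω c * g₂) := by
  have : CompleteSpace X := FiniteDimensional.complete ℂ X
  have hu := isUnit_smul_one_sub_expOp hA1
  obtain ⟨y, hy, hyn⟩ := exists_greenOperator_superposition_eq hω hu hg hg₁ hg₂ hC3 hM
  have h0 : (0 : ℝ) ∈ Set.Icc 0 ω := ⟨le_rfl, hω.le⟩
  have h1 : ω ∈ Set.Icc 0 ω := ⟨hω.le, le_rfl⟩
  have hyp : y ⟨ω, h1⟩ = c • y ⟨0, h0⟩ := by
    rw [← hy]
    exact greenSolution_period hu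
  obtain ⟨Y, hYp, hY⟩ := exists_continuous_extension_period hω hc
    (y := Set.IccExtend hω.le y) y.continuous.Icc_extend'.continuousOn (by
      rw [Set.IccExtend_of_mem _ _ h0, Set.IccExtend_of_mem _ _ h1, hyp])
  have hYy : ∀ t (ht : t ∈ Set.Icc 0 ω), Y t = y ⟨t, ht⟩ := fun t ht => by
    rw [hY t ht, Set.IccExtend_of_mem]
  let f : ℝ → X := fun t => g (t, Y t)
  have hf : Continuous f := by fun_prop
  have hfp : ∀ t, f (t + ω) = c • f t := fun t => by simp only [f, hYp, hC1]
  -- Both sides are `(ω, c)`-periodic, and on `[0, ω]` this is the fixed point equation.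
  have hsol : greenSolution A ω c f = Y := by
    refine eq_of_eqOn_Icc_of_period hω hc (greenSolution_add_period hu hf hfp) hYp fun t ht => ?_
    rw [hYy t ht]
    conv_rhs => rw [← hy]
    refine greenSolution_congr (fun s hs => ?_) ht
    rw [Set.IccExtend_of_mem _ _ hs]
    simp only [f, hYy s hs]
    rfl
  refine ⟨Y, ⟨hω, hc, hYp⟩, fun t => ?_, ?_⟩
  · have h := hasDerivAt_greenSolution (A := A) (ω := ω) (c := c) hf t
    rwa [hsol] at h
  · have hr : Y.restrict (Set.Icc 0 ω) = y := ContinuousMap.ext fun t => hYy t t.2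
    rwa [hr]
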